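/- Let $d,m,k$ be nonnegative integers with $m<d$ and $k\ge 1$, and let $M\subseteq\mathbb R^d$ be a nonempty $m$-dimensional $C^k$ submanifold. That is, for every $\xi\in M$ there are open sets $U,V\subseteq\mathbb R^d$ with $\xi\in U$ and a $C^k$ diffeomorphism $\Psi:V\to U$ such that for all $y=(y_1,\dots,y_d)\in V$ one has $\Psi(y)\in M$ if and only if $y_{m+1}=\dots=y_d=0$. Let $\delta_M(x)=\inf\{\|x-\xi\| : \xi\in M\}$, with $\|\cdot\|$ the Euclidean norm, be the distance function of $M$. Let $\operatorname{unpp}(M)$ be the set of all $x\in\mathbb R^d$ for which there is exactly one $\xi\in M$ with $\|x-\xi\|=\delta_M(x)$; this $\xi$ is denoted by $p(x)$. Let $\mathscr E(M)$ be the interior of $\operatorname{unpp}(M)$. Then the projection $p$ is $C^{k-1}$ on $\mathscr E(M)$ (for $k=1$: continuous), and the distance function $\delta_M$ is $C^k$ on $\mathscr E(M)\setminus M$. -/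

import Mathlib

open Set

/-- `M` is an `m`-dimensional `C^k` submanifold of `ℝ^d` (with `m < d`): around each of its points
there is a `C^k` diffeomorphism `Ψ : V → U` between open subsets of `ℝ^d` (a homeomorphism if
`k = 0`) such that, for `y ∈ V`, one has `Ψ y ∈ M` iff the coordinates of `y` after the first `m`
all vanish. The open sets `V` and `U` are `Ψ.source` and `Ψ.target`. -/
def IsCkSubmanifold {d : ℕ} (m k : ℕ) (M : Set (EuclideanSpace ℝ (Fin d))) : Prop :=
  m < d ∧ ∀ ξ ∈ M,
    ∃ Ψ : OpenPartialHomeomorph (EuclideanSpace ℝ (Fin d)) (EuclideanSpace ℝ (Fin d)),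
      ContDiffOn ℝ k Ψ Ψ.source ∧ ContDiffOn ℝ k Ψ.symm Ψ.target ∧ ξ ∈ Ψ.target ∧
        ∀ y ∈ Ψ.source, Ψ y ∈ M ↔ ∀ i : Fin d, m ≤ (i : ℕ) → y i = 0

/-- The distance function `δ_M`, `x ↦ inf {‖x - ξ‖ : ξ ∈ M}`. -/
noncomputable def distTo {d : ℕ} (M : Set (EuclideanSpace ℝ (Fin d)))
    (x : EuclideanSpace ℝ (Fin d)) : ℝ :=
  Metric.infDist x M

/-- The set `unpp(M)` of all points that have exactly one nearest point on `M`. -/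
def unpp {d : ℕ} (M : Set (EuclideanSpace ℝ (Fin d))) : Set (EuclideanSpace ℝ (Fin d)) :=
  {x | ∃! ξ, ξ ∈ M ∧ ‖x - ξ‖ = distTo M x}

/-- The set `ℰ(M)`: the interior of `unpp(M)`, the maximal open set on which the projection onto
`M` is defined. -/
def projDomain {d : ℕ} (M : Set (EuclideanSpace ℝ (Fin d))) : Set (EuclideanSpace ℝ (Fin d)) :=
  interior (unpp M)

open Classical in
/-- The projection `p` onto `M`: a point of `unpp(M)` is sent to its unique nearest point on `M`.
(Outside `unpp(M)`, where the projection is undefined, the value is the irrelevant default `0`.) -/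
noncomputable def nearestPoint {d : ℕ} (M : Set (EuclideanSpace ℝ (Fin d)))
    (x : EuclideanSpace ℝ (Fin d)) : EuclideanSpace ℝ (Fin d) :=
  if h : x ∈ unpp M then h.choose else 0

theorem nearestPoint_mem {d : ℕ} {M : Set (EuclideanSpace ℝ (Fin d))}
    {x : EuclideanSpace ℝ (Fin d)} (h : x ∈ unpp M) : nearestPoint M x ∈ M := by
  rw [nearestPoint, dif_pos h]
  exact h.choose_spec.1.1

theorem norm_sub_nearestPoint {d : ℕ} {M : Set (EuclideanSpace ℝ (Fin d))}
    {x : EuclideanSpace ℝ (Fin d)} (h : x ∈ unpp M) : ‖x - nearestPoint M x‖ = distTo M x := by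
  rw [nearestPoint, dif_pos h]
  exact h.choose_spec.1.2

theorem eq_nearestPoint {d : ℕ} {M : Set (EuclideanSpace ℝ (Fin d))}
    {x ξ : EuclideanSpace ℝ (Fin d)} (h : x ∈ unpp M) (hξ : ξ ∈ M)
    (hd : ‖x - ξ‖ = distTo M x) : ξ = nearestPoint M x :=
  h.unique ⟨hξ, hd⟩ ⟨nearestPoint_mem h, norm_sub_nearestPoint h⟩

/-! On `ℰ(M)` the projection `p` is continuous by compactness. Comparing nearest points then shows
that `δ²` has gradient `2 (x - p x)`, so `δ²` is one degree smoother than `p`, and so is `δ` off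
`M`, where it is positive.

For the smoothness of `p`, write `p = ψ ∘ u` locally with a chart `ψ`. The parameter `u x` minimizes
`v ↦ ‖x - ψ v‖`, hence solves `⟪x - ψ u, Dψ(u) ·⟫ = 0`. The implicit function theorem applies if the
derivative of this equation in `u`, the form `⟪x - ψ u, D²ψ(w, w)⟫ - ‖Dψ w‖²`, is nondegenerate.
Minimality at `x` alone gives only `≤ 0`. The form is negative definite because `p x` is still
nearest to a point slightly beyond `x` on the ray from `p x` (`exists_extension`).

That extension uses the openness of `ℰ(M)`: `δ` can grow there at every rate below 1, so on a small
ball of radius `r` about `x` it reaches `δ x + r`. Equality in the triangle inequality puts such a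
maximum on the ray. -/

open Filter Topology InnerProductSpace

/-! ### Second-order conditions and the implicit function theorem -/

section SecondOrder

/-- If `c < 0`, the point is also a local maximum, so `f` is locally constant and `c = 0`. -/
theorem IsLocalMin.nonneg_of_hasDerivAt_hasDerivAt {f f' : ℝ → ℝ} {a c : ℝ} (h : IsLocalMin f a)
    (hf : ∀ᶠ t in 𝓝 a, HasDerivAt f (f' t) t) (hf' : HasDerivAt f' c a) : 0 ≤ c := by
  by_contra! hc
  have hd : deriv f =ᶠ[𝓝 a] f' := hf.mono fun t ht ↦ ht.deriv
  have hdd : deriv (deriv f) a = c := by rw [hd.deriv_eq, hf'.deriv]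
  have hmax : IsLocalMax f a :=
    isLocalMax_of_deriv_deriv_neg (hdd ▸ hc) h.deriv_eq_zero hf.self_of_nhds.continuousAt
  have hconst : f =ᶠ[𝓝 a] fun _ ↦ f a := by
    filter_upwards [h, hmax] with t h1 h2 using le_antisymm h2 h1
  have h0 : deriv f =ᶠ[𝓝 a] fun _ ↦ 0 := by
    simpa using hconst.deriv
  rw [h0.deriv_eq, deriv_const] at hdd
  exact hc.ne hdd.symm

variable {E F : Type*} [NormedAddCommGroup E] [InnerProductSpace ℝ E]
  [NormedAddCommGroup F] [NormedSpace ℝ F]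

/-- The derivative, up to sign, of `v ↦ ‖x - ψ v‖ ^ 2 / 2`, as a function of `x` and `v`. -/
noncomputable def criticalEquation (ψ : F → E) (z : E × F) : F →L[ℝ] ℝ :=
  (innerSL ℝ (z.1 - ψ z.2)).comp (fderiv ℝ ψ z.2)

theorem ContDiffAt.criticalEquation {ψ : F → E} {u : F} {n : WithTop ℕ∞} (x : E)
    (hψ : ContDiffAt ℝ (n + 1) ψ u) : ContDiffAt ℝ n (criticalEquation ψ) (x, u) := by
  have h1 : ContDiffAt ℝ n (fun z : E × F ↦ fderiv ℝ ψ z.2) (x, u) :=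
    ContDiffAt.comp (x, u) (g := fderiv ℝ ψ) hψ.fderiv_right_succ contDiffAt_snd
  have h2 : ContDiffAt ℝ n (fun z : E × F ↦ ψ z.2) (x, u) :=
    ContDiffAt.comp (x, u) (g := ψ) (hψ.of_le le_self_add) contDiffAt_snd
  have h3 : ContDiffAt ℝ n (fun z : E × F ↦ innerSL ℝ (z.1 - ψ z.2)) (x, u) :=
    (innerSL ℝ).contDiff.contDiffAt.comp (x, u) (contDiffAt_fst.sub h2)
  exact h3.clm_comp h1

theorem criticalEquation_eq_zero {ψ : F → E} {u : F} {x : E} (hψ : DifferentiableAt ℝ ψ u)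
    (hmin : ∀ᶠ v in 𝓝 u, ‖x - ψ u‖ ≤ ‖x - ψ v‖) : criticalEquation ψ (x, u) = 0 := by
  have hd : HasFDerivAt (fun v ↦ ‖x - ψ v‖ ^ 2)
      (2 • (innerSL ℝ (x - ψ u)).comp (-fderiv ℝ ψ u)) u :=
    (hψ.hasFDerivAt.const_sub x).norm_sq
  have hloc : IsLocalMin (fun v ↦ ‖x - ψ v‖ ^ 2) u := by
    filter_upwards [hmin] with v hv
    gcongr
  have h0 := hloc.hasFDerivAt_eq_zero hd
  ext w
  have := DFunLike.congr_fun h0 w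
  simp [criticalEquation] at this ⊢
  linarith

theorem hasDerivAt_criticalEquation_line {ψ : F → E} {u : F} (x : E) (hψ : ContDiffAt ℝ 2 ψ u)
    (w : F) :
    HasDerivAt (fun t : ℝ ↦ criticalEquation ψ (x, u + t • w) w)
      (⟪x - ψ u, fderiv ℝ (fderiv ℝ ψ) u w w⟫_ℝ - ‖fderiv ℝ ψ u w‖ ^ 2) 0 := by
  have hline : HasDerivAt (fun t : ℝ ↦ u + t • w) w 0 := by
    simpa using ((hasDerivAt_id (0 : ℝ)).smul_const w).const_add u
  have hu : u = u + (0 : ℝ) • w := by simp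
  have h1 : HasDerivAt (fun t : ℝ ↦ ψ (u + t • w)) (fderiv ℝ ψ u w) 0 := by
    refine HasFDerivAt.comp_hasDerivAt (x := (0 : ℝ)) (l := ψ) ?_ hline
    rw [← hu]
    exact (hψ.differentiableAt (by simp)).hasFDerivAt
  have h2 : HasDerivAt (fun t : ℝ ↦ fderiv ℝ ψ (u + t • w)) (fderiv ℝ (fderiv ℝ ψ) u w) 0 := by
    refine HasFDerivAt.comp_hasDerivAt (x := (0 : ℝ)) (l := fderiv ℝ ψ) ?_ hline
    rw [← hu]
    exact ((hψ.fderiv_right (m := 1) (by norm_num)).differentiableAt (by simp)).hasFDerivAt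
  have h3 := (h1.const_sub x).inner ℝ (h2.clm_apply (hasDerivAt_const (0 : ℝ) w))
  simp only [zero_smul, add_zero, map_zero, inner_neg_left, real_inner_self_eq_norm_sq] at h3
  exact h3.congr_deriv (by ring)

theorem inner_fderiv_fderiv_le {ψ : F → E} {u : F} {x : E} (hψ : ContDiffAt ℝ 2 ψ u)
    (hmin : ∀ᶠ v in 𝓝 u, ‖x - ψ u‖ ≤ ‖x - ψ v‖) (w : F) :
    ⟪x - ψ u, fderiv ℝ (fderiv ℝ ψ) u w w⟫_ℝ ≤ ‖fderiv ℝ ψ u w‖ ^ 2 := by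
  have hcont : Tendsto (fun t : ℝ ↦ u + t • w) (𝓝 0) (𝓝 u) :=
    Continuous.tendsto' (by fun_prop) _ _ (by simp)
  have hloc : IsLocalMin (fun t : ℝ ↦ ‖x - ψ (u + t • w)‖ ^ 2) 0 := by
    filter_upwards [hcont.eventually hmin] with t ht
    simp only [zero_smul, add_zero]
    gcongr
  have hd : ∀ᶠ t in 𝓝 (0 : ℝ), HasDerivAt (fun t : ℝ ↦ ‖x - ψ (u + t • w)‖ ^ 2)
      (-2 * criticalEquation ψ (x, u + t • w) w) t := by
    filter_upwards [hcont.eventually (hψ.eventually (by simp))] with t ht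
    have hline : HasDerivAt (fun t : ℝ ↦ u + t • w) w t := by
      simpa using ((hasDerivAt_id t).smul_const w).const_add u
    have h1 := (ht.differentiableAt (by simp)).hasFDerivAt.comp_hasDerivAt t hline
    refine (h1.const_sub x).norm_sq.congr_deriv ?_
    simp [criticalEquation, inner_sub_left]
    ring
  have := hloc.nonneg_of_hasDerivAt_hasDerivAt hd
    ((hasDerivAt_criticalEquation_line x hψ w).const_mul (-2))
  linarith

variable [CompleteSpace E] [FiniteDimensional ℝ F]

/-- Nearest points on a parametrized surface depend regularly on the base point `x₀` if they depend
continuously on it and if the parameter is still a minimizer for a point beyond `x₀`. -/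
theorem contDiffAt_of_isMinimizer {ψ : F → E} {u : E → F} {x₀ : E} {n : ℕ} {ε : ℝ} (hn : n ≠ 0)
    (hψ : ContDiffAt ℝ (n + 1) ψ (u x₀)) (hinj : Function.Injective (fderiv ℝ ψ (u x₀)))
    (hu : ContinuousAt u x₀)
    (hmin : ∀ᶠ x in 𝓝 x₀, ∀ᶠ v in 𝓝 (u x), ‖x - ψ (u x)‖ ≤ ‖x - ψ v‖)
    (hε : 0 < ε) (hext : ∀ᶠ v in 𝓝 (u x₀),
      ‖x₀ + ε • (x₀ - ψ (u x₀)) - ψ (u x₀)‖ ≤ ‖x₀ + ε • (x₀ - ψ (u x₀)) - ψ v‖) :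
    ContDiffAt ℝ n u x₀ := by
  have hn' : (n : WithTop ℕ∞) ≠ 0 := by exact_mod_cast hn
  have hψ2 : ContDiffAt ℝ 2 ψ (u x₀) := by
    refine hψ.of_le ?_
    exact_mod_cast (by omega : 2 ≤ n + 1)
  have hG : ContDiffAt ℝ n (criticalEquation ψ) (x₀, u x₀) := hψ.criticalEquation x₀
  set A := fderiv ℝ (criticalEquation ψ) (x₀, u x₀) ∘L .inr ℝ E F with hA
  have hAw (w : F) : A w w =
      ⟪x₀ - ψ (u x₀), fderiv ℝ (fderiv ℝ ψ) (u x₀) w w⟫_ℝ - ‖fderiv ℝ ψ (u x₀) w‖ ^ 2 := by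
    have hline : HasDerivAt (fun t : ℝ ↦ (x₀, u x₀ + t • w)) ((0, w) : E × F) 0 := by
      simpa using (hasDerivAt_const (0 : ℝ) x₀).prodMk
        (((hasDerivAt_id (0 : ℝ)).smul_const w).const_add (u x₀))
    have h1 : HasDerivAt (fun t : ℝ ↦ criticalEquation ψ (x₀, u x₀ + t • w)) (A w) 0 := by
      refine HasFDerivAt.comp_hasDerivAt (x := (0 : ℝ)) (l := criticalEquation ψ) ?_ hline
      simpa using (hG.differentiableAt hn').hasFDerivAt
    have h2 := h1.clm_apply (hasDerivAt_const (0 : ℝ) w)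
    simp only [map_zero, add_zero] at h2
    exact h2.unique (hasDerivAt_criticalEquation_line x₀ hψ2 w)
  have hAneg (w : F) (hw : w ≠ 0) : A w w < 0 := by
    have hpos : 0 < ‖fderiv ℝ ψ (u x₀) w‖ ^ 2 := by
      have : fderiv ℝ ψ (u x₀) w ≠ 0 := fun h ↦ hw (hinj (by simpa using h))
      positivity
    -- Minimality for the point beyond `x₀` bounds `(1 + ε) * ⟪x₀ - ψ u, D²ψ(w, w)⟫` by `‖Dψ w‖²`.
    -- As the latter is positive, dropping the factor `1 + ε` makes the bound strict.
    have h1 := inner_fderiv_fderiv_le hψ2 hext w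
    rw [show x₀ + ε • (x₀ - ψ (u x₀)) - ψ (u x₀) = (1 + ε) • (x₀ - ψ (u x₀)) by module,
      real_inner_smul_left] at h1
    rw [hAw]
    nlinarith
  have hAinj : Function.Injective (A : F →ₗ[ℝ] F →L[ℝ] ℝ) := by
    refine (injective_iff_map_eq_zero _).2 fun w hw ↦ ?_
    by_contra hne
    have := hAneg w hne
    rw [show A w = 0 from hw] at this
    simp at this
  have hdim : Module.finrank ℝ F = Module.finrank ℝ (F →L[ℝ] ℝ) := by
    rw [← (LinearMap.toContinuousLinearMap (𝕜 := ℝ) (E := F) (F' := ℝ)).finrank_eq]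
    exact Subspace.dual_finrank_eq.symm
  have hAinv : A.IsInvertible :=
    ⟨((A : F →ₗ[ℝ] F →L[ℝ] ℝ).linearEquivOfInjective hAinj hdim).toContinuousLinearEquiv, by
      ext; rfl⟩
  refine (hG.contDiffAt_implicitFunction hn' hAinv).congr_of_eventuallyEq ?_
  have htend : Tendsto (fun x ↦ (x, u x)) (𝓝 x₀) (𝓝 (x₀, u x₀)) := continuousAt_id.prodMk hu
  have hdiff : ∀ᶠ v in 𝓝 (u x₀), ContDiffAt ℝ 2 ψ v := hψ2.eventually (by simp)
  have hzero : ∀ᶠ x in 𝓝 x₀, criticalEquation ψ (x, u x) = 0 := by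
    filter_upwards [hmin, hu.eventually hdiff] with x hx hd
    exact criticalEquation_eq_zero (hd.differentiableAt (by simp)) hx
  -- Near `(x₀, u x₀)` the implicit function gives the only zeros, and continuity of `u` keeps `(x,
  -- u x)` in that neighbourhood.
  filter_upwards [htend.eventually (hG.eventually_apply_eq_iff_implicitFunction hn' hAinv), hzero]
    with x hx h0
  exact (hx.1 (h0.trans hzero.self_of_nhds.symm)).symm

end SecondOrder

/-! ### Continuity of the projection, gradient of the squared distance, extension of normal segments
-/

section Projection

variable {d : ℕ} {M : Set (EuclideanSpace ℝ (Fin d))} {x : EuclideanSpace ℝ (Fin d)}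

theorem isOpen_projDomain : IsOpen (projDomain M) := isOpen_interior

theorem mem_unpp_of_mem_projDomain (hx : x ∈ projDomain M) : x ∈ unpp M := interior_subset hx

theorem distTo_le_norm_sub {ξ : EuclideanSpace ℝ (Fin d)} (hξ : ξ ∈ M) : distTo M x ≤ ‖x - ξ‖ := by
  rw [← dist_eq_norm]
  exact Metric.infDist_le_dist_of_mem hξ

theorem distTo_nonneg : 0 ≤ distTo M x := Metric.infDist_nonneg

theorem continuous_distTo : Continuous (distTo M) := Metric.continuous_infDist_pt M

theorem distTo_pos_iff (hx : x ∈ unpp M) : 0 < distTo M x ↔ x ∉ M := by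
  constructor
  · intro h hxM
    have := distTo_le_norm_sub (x := x) hxM
    simp at this
    linarith
  · intro h
    refine distTo_nonneg.lt_of_ne fun h0 ↦ h ?_
    have := norm_sub_nearestPoint hx
    rw [← h0, norm_eq_zero, sub_eq_zero] at this
    exact this ▸ nearestPoint_mem hx

/-- `M` need not be closed, so the point is to show `ζ ∈ M`. For `y` in `ℰ(M)` slightly along the
segment from `x` to `ζ`, let `q ∈ M` be nearest to `y`. Then `δ x ≤ ‖x - q‖ ≤ ‖x - y‖ + ‖y - q‖ ≤ δ
x`. Equality puts `y` at the same ratio between `x` and `q` as between `x` and `ζ`, whence `q = ζ`.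
-/
theorem eq_nearestPoint_of_mem_closure {ζ : EuclideanSpace ℝ (Fin d)} (hx : x ∈ projDomain M)
    (hζ : ζ ∈ closure M) (hd : ‖x - ζ‖ = distTo M x) : ζ = nearestPoint M x := by
  have hline : Tendsto (fun t : ℝ ↦ AffineMap.lineMap x ζ t) (𝓝[>] 0) (𝓝 x) :=
    (Continuous.tendsto' (by fun_prop) _ _ (by simp)).mono_left nhdsWithin_le_nhds
  obtain ⟨t, hty, ht1, ht0⟩ := ((hline.eventually (isOpen_projDomain.mem_nhds hx)).and
    ((eventually_nhdsWithin_of_eventually_nhds (eventually_lt_nhds one_pos)).and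
      (eventually_mem_nhdsWithin))).exists
  set y := AffineMap.lineMap x ζ t with hy
  have ht0 : 0 < t := ht0
  have hyu := mem_unpp_of_mem_projDomain hty
  set q := nearestPoint M y
  have hq : q ∈ M := nearestPoint_mem hyu
  have hyq : dist y q = distTo M y := by rw [dist_eq_norm]; exact norm_sub_nearestPoint hyu
  have hxζ : dist x ζ = distTo M x := by rw [dist_eq_norm]; exact hd
  have h1 : dist x y = t * distTo M x := by
    rw [hy, dist_left_lineMap, Real.norm_eq_abs, abs_of_pos ht0, hxζ]
  have h2 : distTo M y ≤ (1 - t) * distTo M x := by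
    have : dist y ζ = (1 - t) * distTo M x := by
      rw [hy, dist_lineMap_right, Real.norm_eq_abs, abs_of_pos (by linarith), hxζ]
    rw [← this, distTo, ← Metric.infDist_closure]
    exact Metric.infDist_le_dist_of_mem hζ
  have h3 : distTo M x ≤ dist x q := Metric.infDist_le_dist_of_mem hq
  have h4 := dist_triangle x y q
  have h5 : dist x q = distTo M x := by linarith
  have h6 : y = AffineMap.lineMap x q t := by
    apply eq_lineMap_of_dist_eq_mul_of_dist_eq_mul
    · rw [h1, h5]
    · rw [h5, hyq]; linarith
  have h7 : ζ = q := by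
    rw [hy, AffineMap.lineMap_apply_module, AffineMap.lineMap_apply_module] at h6
    exact smul_right_injective _ ht0.ne' (add_left_cancel h6)
  exact eq_nearestPoint (mem_unpp_of_mem_projDomain hx) (h7 ▸ hq) hd

theorem continuousAt_nearestPoint (hx : x ∈ projDomain M) : ContinuousAt (nearestPoint M) x := by
  have hnear : ∀ᶠ y in 𝓝 x, y ∈ projDomain M := isOpen_projDomain.mem_nhds hx
  -- For `y` near `x`, `‖x - p y‖ ≤ ‖x - y‖ + δ y < 1/2 + (δ x + 1)`, so the values stay in this
  -- ball.
  refine (isCompact_closedBall x (distTo M x + 2)).tendsto_nhds_of_unique_mapClusterPt ?_ ?_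
  · filter_upwards [hnear, Metric.ball_mem_nhds x (half_pos one_pos),
      continuous_distTo.continuousAt.eventually (eventually_lt_nhds (lt_add_one (distTo M x)))]
      with y hy hyx hyd
    have h1 := norm_sub_nearestPoint (mem_unpp_of_mem_projDomain hy)
    rw [← dist_eq_norm] at h1
    rw [Metric.mem_ball] at hyx
    rw [Metric.mem_closedBall, dist_comm]
    have := dist_triangle x y (nearestPoint M y)
    rw [dist_comm x y] at this
    linarith
  · intro ζ _ hζ
    obtain ⟨U, hU, hUζ⟩ := mapClusterPt_iff_ultrafilter.1 hζ
    have hev : ∀ᶠ y in U, y ∈ projDomain M := hU hnear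
    refine eq_nearestPoint_of_mem_closure hx ?_ ?_
    · exact mem_closure_of_tendsto hUζ
        (hev.mono fun y hy ↦ nearestPoint_mem (mem_unpp_of_mem_projDomain hy))
    · have h1 : Tendsto (fun y ↦ ‖y - nearestPoint M y‖) U (𝓝 ‖x - ζ‖) :=
        ((tendsto_id.mono_left hU).sub hUζ).norm
      have h2 : Tendsto (distTo M) U (𝓝 (distTo M x)) :=
        (continuous_distTo.tendsto x).mono_left hU
      exact tendsto_nhds_unique h1 (h2.congr' (hev.mono fun y hy ↦
        (norm_sub_nearestPoint (mem_unpp_of_mem_projDomain hy)).symm))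

/-- Testing `δ x` against `p y` and `δ y` against `p x` bounds the increment of `δ²` on both sides.
The error is at most `‖y - x‖ * (‖y - x‖ + 2 * ‖p y - p x‖)`, which is `o(‖y - x‖)` by continuity of
`p`. -/
theorem hasFDerivAt_distTo_sq (hx : x ∈ projDomain M) :
    HasFDerivAt (fun y ↦ distTo M y ^ 2) ((2 : ℝ) • innerSL ℝ (x - nearestPoint M x)) x := by
  rw [hasFDerivAt_iff_isLittleO]
  have hp := continuousAt_nearestPoint hx
  have hsmall : (fun y ↦ ‖y - x‖ * (‖y - x‖ + 2 * ‖nearestPoint M y - nearestPoint M x‖))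
      =o[𝓝 x] fun y ↦ y - x := by
    have h1 : Tendsto (fun y ↦ ‖y - x‖ + 2 * ‖nearestPoint M y - nearestPoint M x‖) (𝓝 x)
        (𝓝 0) := by
      have h2 : ContinuousAt (fun y ↦ ‖y - x‖ + 2 * ‖nearestPoint M y - nearestPoint M x‖) x := by
        fun_prop
      simpa [ContinuousAt] using h2
    have h3 := (Asymptotics.isBigO_refl (fun y ↦ ‖y - x‖) (𝓝 x)).mul_isLittleO
      ((Asymptotics.isLittleO_one_iff ℝ).2 h1)
    simpa using h3.norm_right
  refine Asymptotics.IsBigO.trans_isLittleO (Asymptotics.IsBigO.of_bound 1 ?_) hsmall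
  filter_upwards [isOpen_projDomain.mem_nhds hx] with y hy
  have hxu := mem_unpp_of_mem_projDomain hx
  have hyu := mem_unpp_of_mem_projDomain hy
  have hx1 := norm_sub_nearestPoint hxu
  have hy1 := norm_sub_nearestPoint hyu
  have hxy : distTo M x ^ 2 ≤ ‖x - nearestPoint M y‖ ^ 2 := by
    have := distTo_le_norm_sub (x := x) (nearestPoint_mem hyu)
    have := distTo_nonneg (M := M) (x := x)
    gcongr
  have hyx : distTo M y ^ 2 ≤ ‖y - nearestPoint M x‖ ^ 2 := by
    have := distTo_le_norm_sub (x := y) (nearestPoint_mem hxu)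
    have := distTo_nonneg (M := M) (x := y)
    gcongr
  set p := nearestPoint M x
  set q := nearestPoint M y
  have e1 : ‖y - p‖ ^ 2 = ‖x - p‖ ^ 2 + 2 * ⟪x - p, y - x⟫_ℝ + ‖y - x‖ ^ 2 := by
    rw [← norm_add_sq_real]; congr 2; abel
  have e2 : ‖y - q‖ ^ 2 = ‖x - q‖ ^ 2 + 2 * ⟪x - q, y - x⟫_ℝ + ‖y - x‖ ^ 2 := by
    rw [← norm_add_sq_real]; congr 2; abel
  have e3 : ⟪x - p, y - x⟫_ℝ = ⟪x - q, y - x⟫_ℝ + ⟪q - p, y - x⟫_ℝ := by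
    rw [← inner_add_left]; congr 1; abel
  have e4 : |⟪q - p, y - x⟫_ℝ| ≤ ‖q - p‖ * ‖y - x‖ := abs_real_inner_le_norm _ _
  have e5 := abs_le.1 e4
  rw [← hx1] at hxy
  rw [← hy1] at hyx
  rw [← hx1, ← hy1]
  rw [one_mul, Real.norm_eq_abs, Real.norm_of_nonneg (by positivity)]
  simp only [smul_apply, innerSL_apply_apply, smul_eq_mul]
  rw [abs_le]
  constructor <;> nlinarith [sq_nonneg ‖y - x‖]

/-- Take for `v` the unit vector from `p x` to `x`, and let `q` be nearest to `x + h • v`. In the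
expansion of `‖x + h • v - q‖²`, `‖x - q‖ ≥ δ x`, and `⟪v, x - q⟫` tends to `δ x` by continuity of
`p`, so it eventually exceeds `c * δ x`. -/
theorem exists_distTo_add_mul_lt (hx : x ∈ projDomain M) (hxM : x ∉ M) {c : ℝ} (hc0 : 0 < c)
    (hc1 : c < 1) : ∃ v : EuclideanSpace ℝ (Fin d), ‖v‖ = 1 ∧
      ∀ᶠ h in 𝓝[>] (0 : ℝ), distTo M x + c * h < distTo M (x + h • v) := by
  have hxu := mem_unpp_of_mem_projDomain hx
  have hpos := (distTo_pos_iff hxu).2 hxM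
  have hx1 := norm_sub_nearestPoint hxu
  set δ := distTo M x with hδ
  set v := δ⁻¹ • (x - nearestPoint M x) with hv
  have hv1 : ‖v‖ = 1 := by
    rw [hv, norm_smul, hx1, norm_inv, Real.norm_of_nonneg hpos.le, inv_mul_cancel₀ hpos.ne']
  refine ⟨v, hv1, ?_⟩
  have hline : ContinuousAt (fun h : ℝ ↦ x + h • v) 0 := by fun_prop
  have hline0 : x = x + (0 : ℝ) • v := by simp
  have hlim : Tendsto (fun h : ℝ ↦ ⟪v, x - nearestPoint M (x + h • v)⟫_ℝ) (𝓝 0) (𝓝 δ) := by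
    have h1 : ContinuousAt (fun h : ℝ ↦ nearestPoint M (x + h • v)) 0 :=
      ContinuousAt.comp (g := nearestPoint M)
        (by rw [← hline0]; exact continuousAt_nearestPoint hx) hline
    have h2 : ContinuousAt (fun h : ℝ ↦ ⟪v, x - nearestPoint M (x + h • v)⟫_ℝ) 0 := by fun_prop
    have h3 : ⟪v, x - nearestPoint M (x + (0 : ℝ) • v)⟫_ℝ = δ := by
      rw [← hline0, hv, real_inner_smul_left, real_inner_self_eq_norm_sq, hx1]
      field_simp
    simpa only [ContinuousAt, h3] using h2
  have hnear : ∀ᶠ h in 𝓝 (0 : ℝ), x + h • v ∈ projDomain M :=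
    hline.eventually (by simpa using isOpen_projDomain.mem_nhds hx)
  filter_upwards [eventually_nhdsWithin_of_eventually_nhds hnear,
    eventually_nhdsWithin_of_eventually_nhds
      (hlim.eventually (eventually_gt_nhds (by nlinarith : c * δ < δ))),
    eventually_mem_nhdsWithin] with h h1 h2 h3
  have h3 : 0 < h := h3
  have hyu := mem_unpp_of_mem_projDomain h1
  have hy1 := norm_sub_nearestPoint hyu
  have hq := distTo_le_norm_sub (x := x) (nearestPoint_mem hyu)
  set q := nearestPoint M (x + h • v)
  have e : ‖x + h • v - q‖ ^ 2 = ‖x - q‖ ^ 2 + 2 * (h * ⟪v, x - q⟫_ℝ) + h ^ 2 := by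
    rw [show x + h • v - q = (x - q) + h • v by abel, norm_add_sq_real, real_inner_smul_right,
      norm_smul, hv1, real_inner_comm, mul_one, Real.norm_eq_abs, sq_abs]
  refine lt_of_pow_lt_pow_left₀ 2 distTo_nonneg ?_
  rw [← hy1, e]
  have hq2 : δ ^ 2 ≤ ‖x - q‖ ^ 2 := by gcongr
  have h4 : h * (c * δ) < h * ⟪v, x - q⟫_ℝ := by gcongr
  have h5 : c ^ 2 * h ^ 2 ≤ h ^ 2 := by
    have : c ^ 2 ≤ 1 := by nlinarith
    nlinarith [sq_nonneg h]
  nlinarith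

/-- Any point of `ℰ(M)` can be moved away from its projection without changing the projection. -/
theorem exists_extension (hx : x ∈ projDomain M) :
    ∃ ε : ℝ, 0 < ε ∧ ∀ q ∈ M,
      ‖x + ε • (x - nearestPoint M x) - nearestPoint M x‖ ≤
        ‖x + ε • (x - nearestPoint M x) - q‖ := by
  have hxu := mem_unpp_of_mem_projDomain hx
  by_cases hxM : x ∈ M
  · have : x = nearestPoint M x := by
      refine eq_nearestPoint hxu hxM ?_
      have := distTo_le_norm_sub (x := x) hxM
      simp only [sub_self, norm_zero] at this ⊢
      exact le_antisymm distTo_nonneg this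
    refine ⟨1, one_pos, fun q _ ↦ ?_⟩
    rw [← this]
    simp
  have hpos := (distTo_pos_iff hxu).2 hxM
  have hx1 := norm_sub_nearestPoint hxu
  set δ := distTo M x with hδ
  set p := nearestPoint M x with hp
  obtain ⟨r, hr, hball⟩ : ∃ r > 0, Metric.closedBall x r ⊆ projDomain M ∩ {y | 0 < distTo M y} :=
    Metric.nhds_basis_closedBall.mem_iff.1 (Filter.inter_mem (isOpen_projDomain.mem_nhds hx)
      (continuous_distTo.continuousAt.eventually (eventually_gt_nhds hpos)))
  have hcomp : IsCompact (Metric.closedBall x r) := isCompact_closedBall x r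
  have hnonempty : (Metric.closedBall x r).Nonempty := ⟨x, Metric.mem_closedBall_self hr.le⟩
  have hgrow (c : ℝ) (hc0 : 0 < c) (hc1 : c < 1) :
      ∃ y ∈ Metric.closedBall x r, δ + c * r ≤ distTo M y := by
    -- A maximum of the penalized distance must lie on the sphere: from an interior point, moving in
    -- a direction of growth faster than `c` would increase it.
    obtain ⟨y, hy, hmax⟩ := hcomp.exists_isMaxOn hnonempty
      (f := fun y ↦ distTo M y - c * ‖y - x‖)
      (by have := continuous_distTo (M := M); fun_prop)
    refine ⟨y, hy, ?_⟩
    have h0 : δ ≤ distTo M y - c * ‖y - x‖ := by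
      simpa using hmax (Metric.mem_closedBall_self hr.le)
    have hyr : ‖y - x‖ ≤ r := by simpa [dist_eq_norm] using hy
    rcases hyr.eq_or_lt with heq | hlt
    · rw [heq] at h0; linarith
    exfalso
    have hyp := hball hy
    obtain ⟨v, hv, hev⟩ := exists_distTo_add_mul_lt hyp.1
      ((distTo_pos_iff (mem_unpp_of_mem_projDomain hyp.1)).1 hyp.2) hc0 hc1
    have hin : ∀ᶠ h in 𝓝[>] (0 : ℝ), ‖y + h • v - x‖ < r := by
      have hcont : ContinuousAt (fun h : ℝ ↦ ‖y + h • v - x‖) 0 := by fun_prop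
      exact eventually_nhdsWithin_of_eventually_nhds
        (hcont.eventually (eventually_lt_nhds (by simpa using hlt)))
    obtain ⟨h, h1, h2, h3⟩ := (hev.and (hin.and eventually_mem_nhdsWithin)).exists
    have h3 : 0 < h := h3
    have h4 : distTo M (y + h • v) - c * ‖y + h • v - x‖ ≤ distTo M y - c * ‖y - x‖ :=
      hmax (by simpa [dist_eq_norm] using h2.le)
    have h5 : ‖y + h • v - x‖ ≤ ‖y - x‖ + h := by
      calc ‖y + h • v - x‖ = ‖(y - x) + h • v‖ := by congr 1; abel
        _ ≤ ‖y - x‖ + ‖h • v‖ := norm_add_le _ _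
        _ = ‖y - x‖ + h := by rw [norm_smul, hv, mul_one, Real.norm_of_nonneg h3.le]
    nlinarith
  obtain ⟨y, hy, hmax⟩ := hcomp.exists_isMaxOn hnonempty (continuous_distTo (M := M)).continuousOn
  have hfar : δ + r ≤ distTo M y := by
    have hlim : Tendsto (fun c : ℝ ↦ δ + c * r) (𝓝[<] 1) (𝓝 (δ + r)) :=
      (Continuous.tendsto' (by fun_prop) _ _ (by simp)).mono_left nhdsWithin_le_nhds
    refine le_of_tendsto hlim ?_
    filter_upwards [eventually_nhdsWithin_of_eventually_nhds (eventually_gt_nhds one_pos),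
      eventually_mem_nhdsWithin] with c hc0 hc1
    obtain ⟨z, hz, hzd⟩ := hgrow c hc0 hc1
    exact hzd.trans (hmax hz)
  have hpM : p ∈ M := nearestPoint_mem hxu
  have hpx : dist p x = δ := by rw [dist_comm, dist_eq_norm]; exact hx1
  have hxy : dist x y ≤ r := by rw [dist_comm]; exact hy
  have hpy : distTo M y ≤ dist p y := by rw [dist_comm]; exact Metric.infDist_le_dist_of_mem hpM
  -- Here `δ + r ≤ δ_M(y) ≤ dist p y ≤ dist p x + dist x y ≤ δ + r`, so all are equalities: `y` lies
  -- on the ray from `p` through `x`, and `p` is nearest to `y`.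
  have htri := dist_triangle p x y
  have hpy' : dist p y = δ + r := by linarith
  have hxy' : dist x y = r := by linarith
  have hlm : x = AffineMap.lineMap p y (δ / (δ + r)) := by
    apply eq_lineMap_of_dist_eq_mul_of_dist_eq_mul
    · rw [hpx, hpy']; field_simp
    · rw [hxy', hpy']; field_simp; ring
  have hy_eq : x + (r / δ) • (x - p) = y := by
    have h1 : x - p = (δ / (δ + r)) • (y - p) := by
      nth_rewrite 1 [hlm]
      rw [AffineMap.lineMap_apply_module]
      module
    have h2 : x = p + (δ / (δ + r)) • (y - p) := by rw [← h1]; abel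
    have h3 : δ / (δ + r) + (r / δ) * (δ / (δ + r)) = 1 := by field_simp
    calc x + (r / δ) • (x - p)
        = p + (δ / (δ + r)) • (y - p) + (r / δ) • (δ / (δ + r)) • (y - p) := by rw [h1, ← h2]
      _ = p + (δ / (δ + r) + (r / δ) * (δ / (δ + r))) • (y - p) := by module
      _ = y := by rw [h3]; module
  refine ⟨r / δ, by positivity, fun q hq ↦ ?_⟩
  rw [hy_eq]
  calc ‖y - p‖ = dist p y := by rw [dist_comm, dist_eq_norm]
    _ ≤ distTo M y := by linarith
    _ ≤ ‖y - q‖ := distTo_le_norm_sub hq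

end Projection

/-! ### Regularity of the projection and of the distance in charts -/

section Regularity

variable {d : ℕ} {M : Set (EuclideanSpace ℝ (Fin d))} {x : EuclideanSpace ℝ (Fin d)}

/-- The subspace of `ℝ^d` on which all coordinates after the first `m` vanish. -/
def coordSubspace (d m : ℕ) : Submodule ℝ (EuclideanSpace ℝ (Fin d)) where
  carrier := {y | ∀ i : Fin d, m ≤ (i : ℕ) → y i = 0}
  zero_mem' := by simp
  add_mem' := fun ha hb i hi ↦ by simp [ha i hi, hb i hi]
  smul_mem' := fun c y hy i hi ↦ by simp [hy i hi]

theorem contDiffAt_nearestPoint {m n : ℕ} (hn : n ≠ 0) (hM : IsCkSubmanifold m (n + 1) M)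
    (hx : x ∈ projDomain M) : ContDiffAt ℝ n (nearestPoint M) x := by
  have hcont := continuousAt_nearestPoint hx
  have hnear : ∀ᶠ y in 𝓝 x, y ∈ projDomain M := isOpen_projDomain.mem_nhds hx
  have hpM (y : EuclideanSpace ℝ (Fin d)) (hy : y ∈ projDomain M) : nearestPoint M y ∈ M :=
    nearestPoint_mem (mem_unpp_of_mem_projDomain hy)
  obtain ⟨Ψ, hΨ, hΨs, hξ, hΨM⟩ := hM.2 _ (hpM x hx)
  push_cast at hΨ hΨs
  set W := coordSubspace d m
  -- This projection only serves to make `u` a `W`-valued function on the whole space; near `x` the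
  -- chart coordinates of `p y` already lie in `W`.
  set π := W.orthogonalProjectionOnto
  set ψ : W → EuclideanSpace ℝ (Fin d) := fun w ↦ Ψ w
  set u : EuclideanSpace ℝ (Fin d) → W := fun y ↦ π (Ψ.symm (nearestPoint M y))
  have hu_coe (y : EuclideanSpace ℝ (Fin d)) (hy : y ∈ projDomain M)
      (hyt : nearestPoint M y ∈ Ψ.target) : (u y : EuclideanSpace ℝ (Fin d)) =
        Ψ.symm (nearestPoint M y) := by
    have hW : Ψ.symm (nearestPoint M y) ∈ W := by
      refine (hΨM _ (Ψ.map_target hyt)).1 ?_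
      rw [Ψ.right_inv hyt]
      exact hpM y hy
    exact Submodule.starProjection_eq_self_iff.2 hW
  have hψu (y : EuclideanSpace ℝ (Fin d)) (hy : y ∈ projDomain M)
      (hyt : nearestPoint M y ∈ Ψ.target) : ψ (u y) = nearestPoint M y := by
    simp only [ψ]
    rw [hu_coe y hy hyt, Ψ.right_inv hyt]
  have hu_source (y : EuclideanSpace ℝ (Fin d)) (hy : y ∈ projDomain M)
      (hyt : nearestPoint M y ∈ Ψ.target) : (u y : EuclideanSpace ℝ (Fin d)) ∈ Ψ.source := by
    rw [hu_coe y hy hyt]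
    exact Ψ.map_target hyt
  have htarget : ∀ᶠ y in 𝓝 x, nearestPoint M y ∈ Ψ.target :=
    hcont.eventually (Ψ.open_target.mem_nhds hξ)
  have hψM (w : W) (hw : (w : EuclideanSpace ℝ (Fin d)) ∈ Ψ.source) : ψ w ∈ M :=
    (hΨM _ hw).2 w.2
  have hsource (y : EuclideanSpace ℝ (Fin d)) (hy : y ∈ projDomain M)
      (hyt : nearestPoint M y ∈ Ψ.target) :
      ∀ᶠ w : W in 𝓝 (u y), (w : EuclideanSpace ℝ (Fin d)) ∈ Ψ.source :=
    continuous_subtype_val.continuousAt.eventually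
      (Ψ.open_source.mem_nhds (hu_source y hy hyt))
  have hx_source := hu_source x hx hξ
  have hψ : ContDiffAt ℝ (n + 1) ψ (u x) :=
    ContDiffAt.comp (u x) (g := Ψ) (hΨ.contDiffAt (Ψ.open_source.mem_nhds hx_source))
      W.subtypeL.contDiff.contDiffAt
  have hu : ContinuousAt u x :=
    π.continuous.continuousAt.comp ((Ψ.continuousAt_symm hξ).comp hcont)
  -- Differentiating `Ψ.symm ∘ ψ = id` on `W` gives a left inverse of the derivative of `ψ`.
  have hinj : Function.Injective (fderiv ℝ ψ (u x)) := by
    have h1 : HasFDerivAt Ψ.symm (fderiv ℝ Ψ.symm (ψ (u x))) (ψ (u x)) := by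
      rw [hψu x hx hξ]
      exact ((hΨs.contDiffAt (Ψ.open_target.mem_nhds hξ)).differentiableAt (by simp)).hasFDerivAt
    have h2 := h1.comp (u x) (hψ.differentiableAt (by simp)).hasFDerivAt
    have h3 : HasFDerivAt (Ψ.symm ∘ ψ) W.subtypeL (u x) := by
      refine W.subtypeL.hasFDerivAt.congr_of_eventuallyEq ?_
      filter_upwards [hsource x hx hξ] with w hw using Ψ.left_inv hw
    intro a b hab
    have h4 := h2.unique h3
    have ha := DFunLike.congr_fun h4 a
    have hb := DFunLike.congr_fun h4 b
    simp only [ContinuousLinearMap.comp_apply, Submodule.subtypeL_apply] at ha hb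
    rw [hab] at ha
    exact Subtype.ext (ha.symm.trans hb)
  obtain ⟨ε, hε, hext⟩ := exists_extension hx
  have hun : ContDiffAt ℝ n u x := by
    refine contDiffAt_of_isMinimizer hn hψ hinj hu ?_ hε ?_
    · filter_upwards [hnear, htarget] with y hy hyt
      filter_upwards [hsource y hy hyt] with w hw
      rw [hψu y hy hyt, norm_sub_nearestPoint (mem_unpp_of_mem_projDomain hy)]
      exact distTo_le_norm_sub (hψM w hw)
    · filter_upwards [hsource x hx hξ] with w hw
      rw [hψu x hx hξ]
      exact hext _ (hψM w hw)
  have hcomp : ContDiffAt ℝ n (ψ ∘ u) x := (hψ.of_le le_self_add).comp x hun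
  refine hcomp.congr_of_eventuallyEq ?_
  filter_upwards [hnear, htarget] with y hy hyt using (hψu y hy hyt).symm

theorem contDiffOn_nearestPoint {m n : ℕ} (hM : IsCkSubmanifold m (n + 1) M) :
    ContDiffOn ℝ n (nearestPoint M) (projDomain M) := by
  intro x hx
  -- For `n = 0` the charts are only `C¹`, the critical equation is merely continuous, and the
  -- continuity of `p` is all that is claimed.
  rcases eq_or_ne n 0 with rfl | hn
  · have hc : ContinuousOn (nearestPoint M) (projDomain M) := fun y hy ↦
      (continuousAt_nearestPoint hy).continuousWithinAt
    exact_mod_cast contDiffOn_zero.2 hc x hx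
  · exact (contDiffAt_nearestPoint hn hM hx).contDiffWithinAt

theorem contDiffOn_distTo_sq {n : ℕ} (hp : ContDiffOn ℝ n (nearestPoint M) (projDomain M)) :
    ContDiffOn ℝ (n + 1) (fun y ↦ distTo M y ^ 2) (projDomain M) := by
  refine (contDiffOn_succ_iff_fderiv_of_isOpen isOpen_projDomain).2 ⟨fun y hy ↦
    (hasFDerivAt_distTo_sq hy).differentiableAt.differentiableWithinAt, by simp, ?_⟩
  have h : ContDiffOn ℝ n (fun y ↦ (2 : ℝ) • innerSL ℝ (y - nearestPoint M y)) (projDomain M) :=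
    ((innerSL ℝ).contDiff.comp_contDiffOn (contDiffOn_id.sub hp)).const_smul (2 : ℝ)
  exact h.congr fun y hy ↦ (hasFDerivAt_distTo_sq hy).fderiv

end Regularity

theorem mainTheorem5 {d m k : ℕ} (hk : 1 ≤ k) (M : Set (EuclideanSpace ℝ (Fin d)))
    (hne : M.Nonempty) (hM : IsCkSubmanifold m k M) :
    ContDiffOn ℝ ((k - 1 : ℕ) : WithTop ℕ∞) (nearestPoint M) (projDomain M) ∧
      ContDiffOn ℝ (k : WithTop ℕ∞) (distTo M) (projDomain M \ M) := by
  obtain ⟨n, rfl⟩ := Nat.exists_eq_add_of_le' hk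
  have hp := contDiffOn_nearestPoint hM
  refine ⟨by simpa using hp, ?_⟩
  -- The square root is smooth away from `0`, and `δ` is positive off `M` because a nearest point is
  -- attained in `M`.
  have hsq := ((contDiffOn_distTo_sq hp).mono (sdiff_subset (t := M))).sqrt fun y hy ↦
    pow_ne_zero 2 ((distTo_pos_iff (mem_unpp_of_mem_projDomain hy.1)).2 hy.2).ne'
  push_cast
  exact hsq.congr fun y _ ↦ (Real.sqrt_sq distTo_nonneg).symm
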